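/- Let $k\ge 1$, $n\ge 2$ be integers, let $\Omega>0$ and $\sigma$ be real numbers, and put $\xi(m)=\sum_{j=1}^{m}\frac1j$ (so $\xi(0)=0$). Let $\mu=\sum_{j=1}^n a_j\delta_{\mathbf y_j}$ with $a_j\in\mathbb C\setminus\{0\}$, $\mathbf y_j\in\mathbb R^k$ and $\|\mathbf y_j\|_2\le \frac{(n-1)\pi}{2\Omega}$, and let $$m_{\min}=\min_{1\le j\le n}|a_j|,\qquad d_{\min}=\min_{p\ne j}\|\mathbf y_p-\mathbf y_j\|_2,\qquad SRF=\frac{\pi}{\Omega\, d_{\min}}.$$ For a discrete measure $\gamma=\sum_j c_j\delta_{\mathbf z_j}$ write $\mathcal F\gamma(\boldsymbol\omega)=\sum_j c_j e^{i\mathbf z_j\cdot\boldsymbol\omega}$. Let $\mathbf Y(\boldsymbol\omega)=\mathcal F\mu(\boldsymbol\omega)+\mathbf W(\boldsymbol\omega)$ for $\boldsymbol\omega\in\mathbb R^k$, $\|\boldsymbol\omega\|_2\le\Omega$, be a measurement with noise $\mathbf W$ satisfying $\sup_{\|\boldsymbol\omega\|_2\le\Omega}|\mathbf W(\boldsymbol\omega)|<\sigma$.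 Suppose that $$d_{\min}\ \ge\ \frac{5.88\,\pi e\,4^{k-1}\big(\frac{(n+2)(n-1)}{2}\big)^{\xi(k-1)}}{\Omega}\Big(\frac{\sigma}{m_{\min}}\Big)^{\frac1{2n-1}}.$$ Let $\hat\mu=\sum_{j=1}^n\hat a_j\delta_{\hat{\mathbf y}_j}$ with $\hat a_j\in\mathbb C$, $\hat{\mathbf y}_j\in\mathbb R^k$, $\|\hat{\mathbf y}_j\|_2\le\frac{(n-1)\pi}{2\Omega}$, be $\sigma$-admissible for $\mathbf Y$, that is, $\sup_{\|\boldsymbol\omega\|_2\le\Omega}|\mathcal F\hat\mu(\boldsymbol\omega)-\mathbf Y(\boldsymbol\omega)|<\sigma$. Then $\hat\mu$ is within the $\frac{d_{\min}}2$-neighborhood of $\mu$: $d_{\min}>0$, the open balls of radius $\frac{d_{\min}}{2}$ centred at $\mathbf y_1,\dots,\mathbf y_n$ are pairwise disjoint, and each $\hat{\mathbf y}_j$ lies in one and only one of them. Moreover, after reordering the $\hat{\mathbf y}_j$, for every $1\le j\le n$ the point $\hat{\mathbf y}_j$ lies in the ball centred at $\mathbf y_j$ and $$\|\hat{\mathbf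 y}_j-\mathbf y_j\|_2\le\frac{C(k,n)}{\Omega}\,SRF^{2n-2}\,\frac{\sigma}{m_{\min}},\qquad C(k,n)=\Big(4^{k-1}\big(\tfrac{(n+2)(n-1)}{2}\big)^{\xi(k-1)}\Big)^{2n-1} n\,2^{4n-2}e^{2n}\pi^{-1/2}.$$ -/

import Mathlib

namespace PointSources

open scoped ENNReal

/-- The space `ℝᵏ` with its Euclidean norm. -/
abbrev E (k : ℕ) : Type := EuclideanSpace ℝ (Fin k)

/-- A discrete measure `∑ j, a_j δ_{y_j}` on `ℝᵏ`, given by its `n` complex amplitudes `a_j`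
and its `n` locations `y_j`. -/
structure DiscreteMeasure (k n : ℕ) where
  amp : Fin n → ℂ
  loc : Fin n → E k

variable {k n : ℕ}

/-- The Fourier transform `ω ↦ ∑ j, a_j exp(i y_j · ω)`. -/
noncomputable def DiscreteMeasure.fourier (μ : DiscreteMeasure k n) (ω : E k) : ℂ :=
  ∑ j, μ.amp j * Complex.exp (Complex.I * ((inner ℝ (μ.loc j) ω : ℝ) : ℂ))

/-- The measure is `n`-sparse: none of its `n` amplitudes is zero. -/
def DiscreteMeasure.IsSparse (μ : DiscreteMeasure k n) : Prop := ∀ j, μ.amp j ≠ 0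

/-- All the locations lie in the ball of radius `r` about the origin. -/
def DiscreteMeasure.SupportedInBall (μ : DiscreteMeasure k n) (r : ℝ) : Prop :=
  ∀ j, ‖μ.loc j‖ ≤ r

/-- `m_min = min_j |a_j|`. -/
noncomputable def DiscreteMeasure.mMin (μ : DiscreteMeasure k n) : ℝ := ⨅ j, ‖μ.amp j‖

/-- `d_min = min_{p ≠ j} ‖y_p - y_j‖`. -/
noncomputable def DiscreteMeasure.dMin (μ : DiscreteMeasure k n) : ℝ :=
  ⨅ q : {q : Fin n × Fin n // q.1 ≠ q.2}, ‖μ.loc q.1.1 - μ.loc q.1.2‖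

/-- The sup norm of `f` over the frequencies `ω` with `‖ω‖ ≤ Ω`, as an extended number. -/
noncomputable def supNorm (Ω : ℝ) (f : E k → ℂ) : ℝ≥0∞ :=
  ⨆ ω : E k, ⨆ _ : ‖ω‖ ≤ Ω, ‖f ω‖ₑ

/-- `Y` is a measurement of `μ` with cut-off frequency `Ω` and noise level `σ`:
on `‖ω‖ ≤ Ω` it is the Fourier transform of `μ` plus a noise `W` of sup norm less than `σ`.
The values of `Y` outside that ball play no role. -/
def IsMeasurement (Ω σ : ℝ) (μ : DiscreteMeasure k n) (Y : E k → ℂ) : Prop :=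
  ∃ W : E k → ℂ, (∀ ω, ‖ω‖ ≤ Ω → Y ω = μ.fourier ω + W ω) ∧ supNorm Ω W < ENNReal.ofReal σ

/-- `ν` is a `σ`-admissible discrete measure of the measurement `Y`. -/
def IsAdmissible (Ω σ : ℝ) (Y : E k → ℂ) (ν : DiscreteMeasure k n) : Prop :=
  supNorm Ω (fun ω => ν.fourier ω - Y ω) < ENNReal.ofReal σ

/-- `ν` is within the `δ`-neighborhood of `μ`: the `δ`-balls about the locations of `μ` are
pairwise disjoint, and each location of `ν` is in one and only one of these balls. -/
def WithinNeighborhood (δ : ℝ) (ν μ : DiscreteMeasure k n) : Prop :=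
  0 < δ ∧
    (∀ p q, p ≠ q → Disjoint (Metric.ball (μ.loc p) δ) (Metric.ball (μ.loc q) δ)) ∧
    ∀ j, ∃! p, ν.loc j ∈ Metric.ball (μ.loc p) δ

/-- `ξ(k) = ∑_{j=1}^k 1/j`, with `ξ(0) = 0`. -/
noncomputable def xi (k : ℕ) : ℝ := ∑ j ∈ Finset.Icc 1 k, 1 / (j : ℝ)

/-- The super-resolution factor `π / (Ω d_min)`. -/
noncomputable def srf (Ω : ℝ) (μ : DiscreteMeasure k n) : ℝ := Real.pi / (Ω * μ.dMin)

/-- `4^{k-1} ((n+2)(n-1)/2)^{ξ(k-1)}`, for `k ≥ 1`. -/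
noncomputable def dimFactor (k n : ℕ) : ℝ :=
  (4 : ℝ) ^ (k - 1) * (((n : ℝ) + 2) * ((n : ℝ) - 1) / 2) ^ xi (k - 1)

/-- `C(k,n) = (4^{k-1} ((n+2)(n-1)/2)^{ξ(k-1)})^{2n-1} n 2^{4n-2} e^{2n} π^{-1/2}`. -/
noncomputable def constC (k n : ℕ) : ℝ :=
  dimFactor k n ^ (2 * n - 1) * n * 2 ^ (4 * n - 2) * Real.exp (2 * (n : ℝ)) *
    Real.pi ^ (-(1 / 2) : ℝ)

end PointSources

/-! On the line, the Fourier transforms of the two measures differ by at most `2 * σ` on `[-Ω, Ω]`.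
Sampled at `2n` equally spaced frequencies, their difference is a sum of powers of `2n` nodes on the
unit circle, and the difference operators killing every node except that of `y_p` isolate the
amplitude `a_p`. The support bound keeps the phases within `π` of each other, so chords are
comparable to distances and the product of the distances from `y_p` to all other locations of both
measures is small (`norm_mul_prod_dist_le`). Hence the monic polynomial with roots `ŷ_q` is small at
every `y_p`. By Lagrange interpolation it has the sign of `∏ (x - y_j)` at `y_p ± 2K`, so it changes
sign in between and has a root there (`exists_root_near_node`).

In `ℝᵏ` no induction on the dimension is needed. For each `p`, a volume comparison in a cube
(`exists_direction`) yields one direction nearly orthogonal neither to any `y_i - y_j` nor to any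
`ŷ_q - y_p`. Projection to it keeps the separation up to the factor `dimFactor`, and nearness of
`ŷ_q` to `y_p` on the line lifts back with the same loss. Disjointness of the balls makes `p ↦ q`
injective, hence a permutation. -/

namespace PointSources

/-! ### Isolating one amplitude of an exponential sum -/

/-- Applying the difference operators `e ↦ (t ↦ e (t + 1) - r e t)` for `r` in a finite family of
complex numbers of modulus at most one to an exponential sum. -/
theorem norm_sum_mul_prod_sub_le {ι κ : Type*} [Fintype ι] (s : Finset κ) (r : κ → ℂ)
    (hr : ∀ l ∈ s, ‖r l‖ ≤ 1) (z : ι → ℂ) (c : ι → ℂ) (M : ℝ)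
    (h : ∀ t ≤ s.card, ‖∑ i, c i * z i ^ t‖ ≤ M) :
    ‖∑ i, c i * ∏ l ∈ s, (z i - r l)‖ ≤ 2 ^ s.card * M := by
  classical
  induction s using Finset.induction_on generalizing c M with
  | empty => simpa using h 0 le_rfl
  | insert l s hl ih =>
    rw [Finset.card_insert_of_notMem hl] at h ⊢
    -- One difference multiplies the coefficient of `z i` by `z i - r l` and at most doubles the
    -- bound, since `‖r l‖ ≤ 1`.
    have key := ih (fun i hi => hr i (Finset.mem_insert_of_mem hi)) (fun i => c i * (z i - r l))
      (2 * M) (fun t ht => by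
        have h1 := h (t + 1) (by omega)
        have h2 := h t (by omega)
        have hl1 := hr l (Finset.mem_insert_self _ _)
        have e : ∑ i, c i * (z i - r l) * z i ^ t
            = ∑ i, c i * z i ^ (t + 1) - r l * ∑ i, c i * z i ^ t := by
          rw [Finset.mul_sum, ← Finset.sum_sub_distrib]
          exact Finset.sum_congr rfl fun i _ => by ring
        rw [e]
        refine (norm_sub_le _ _).trans ?_
        rw [norm_mul]
        nlinarith [norm_nonneg (∑ i, c i * z i ^ t), norm_nonneg (r l)])
    calc _ = ‖∑ i, c i * (z i - r l) * ∏ x ∈ s, (z i - r x)‖ := by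
          congr 1
          exact Finset.sum_congr rfl fun i _ => by rw [Finset.prod_insert hl, mul_assoc]
      _ ≤ _ := key
      _ = _ := by ring

/-- The amplitude at one node of an exponential sum that is small at `card ι` consecutive
integers. -/
theorem norm_mul_prod_sub_le {ι : Type*} [Fintype ι] [DecidableEq ι] (z c : ι → ℂ)
    (hz : ∀ i, ‖z i‖ ≤ 1) (M : ℝ)
    (h : ∀ t < Fintype.card ι, ‖∑ i, c i * z i ^ t‖ ≤ M) (p : ι) :
    ‖c p‖ * ∏ l ∈ Finset.univ.erase p, ‖z p - z l‖ ≤ 2 ^ (Fintype.card ι - 1) * M := by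
  have hpos : 0 < Fintype.card ι := Fintype.card_pos_iff.2 ⟨p⟩
  have hc : (Finset.univ.erase p).card = Fintype.card ι - 1 := by
    rw [Finset.card_erase_of_mem (Finset.mem_univ p), Finset.card_univ]
  -- With the other nodes as the family `r`, every term but that of `p` vanishes; the nodes need not
  -- be distinct.
  have key := norm_sum_mul_prod_sub_le (Finset.univ.erase p) z (fun l _ => hz l) z c M
    (fun t ht => h t (by omega))
  rw [hc, Finset.sum_eq_single p, norm_mul, norm_prod] at key
  · exact key
  · intro i _ hi
    rw [Finset.prod_eq_zero (i := i) (by simp [hi]) (sub_self _), mul_zero]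
  · simp

/-! ### Roots of a monic polynomial that is small at given nodes -/

open Polynomial in
/-- Lagrange interpolation of the difference of two monic polynomials of the same degree given by
their roots, away from the nodes. -/
theorem prod_sub_eq_prod_sub_mul {n : ℕ} (a b : Fin n → ℝ) (ha : Function.Injective a) (x : ℝ)
    (hx : ∀ i, x ≠ a i) :
    ∏ q, (x - b q) = (∏ i, (x - a i)) *
      (1 + ∑ p, (∏ q, (a p - b q)) / (∏ j ∈ Finset.univ.erase p, (a p - a j)) / (x - a p)) := by
  set f : ℝ[X] := ∏ q, (X - C (b q)) - ∏ i, (X - C (a i)) with hf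
  have hb1 : (∏ q, (X - C (b q))).Monic := monic_prod_of_monic _ _ fun i _ => monic_X_sub_C _
  have ha1 : (∏ q, (X - C (a q))).Monic := monic_prod_of_monic _ _ fun i _ => monic_X_sub_C _
  have hb2 : (∏ q, (X - C (b q))).degree = ((n : ℕ) : WithBot ℕ) := by
    simp [degree_prod]
  have ha2 : (∏ q, (X - C (a q))).degree = ((n : ℕ) : WithBot ℕ) := by
    simp [degree_prod]
  have hdeg : f.degree < (Finset.univ : Finset (Fin n)).card := by
    rw [Finset.card_univ, Fintype.card_fin]
    have := degree_sub_lt_left (hb2.trans ha2.symm) hb1.ne_zero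
      (by rw [hb1.leadingCoeff, ha1.leadingCoeff])
    rwa [hb2] at this
  -- The polynomial with roots `a` vanishes at the nodes, so there `f` takes the values of the other
  -- one.
  have key := Lagrange.eq_interpolate_of_eval_eq (r := fun i => ∏ q, (a i - b q)) (v := a)
    (ha.injOn) hdeg (fun i _ => by
      have : ∏ j, (a i - a j) = 0 := Finset.prod_eq_zero (Finset.mem_univ i) (sub_self _)
      simp [hf, eval_prod, this])
  have e := congrArg (eval x) key
  rw [Lagrange.eval_interpolate_not_at_node _ (fun i _ => hx i)] at e
  simp only [hf, eval_sub, eval_prod, eval_X, eval_C, Lagrange.eval_nodal] at e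
  rw [mul_add, mul_one, ← sub_eq_iff_eq_add', e]
  congr 1
  refine Finset.sum_congr rfl fun p _ => ?_
  rw [Lagrange.nodalWeight, Finset.prod_inv_distrib]
  ring

/-- If the monic polynomial with roots `b` is small at `D`-separated nodes `a`, relative to the
products of the distances between the nodes, then it has a root near each node. -/
theorem exists_root_near_node {n : ℕ} (hn : 1 ≤ n) (a b : Fin n → ℝ) (D K : ℝ) (hK : 0 < K)
    (hsep : ∀ p q, p ≠ q → D ≤ |a p - a q|) (hKD : 4 * n * K ≤ D)
    (hQ : ∀ p, ∏ q, |a p - b q| ≤ K * ∏ j ∈ Finset.univ.erase p, |a p - a j|) (p : Fin n) :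
    ∃ q, |b q - a p| ≤ 2 * K := by
  have hn' : (1 : ℝ) ≤ n := by exact_mod_cast hn
  have hD4 : 4 * K ≤ D := by nlinarith
  have hD : 0 < D := by linarith
  have hinj : Function.Injective a := fun i j hij => by
    by_contra hne
    have := hsep i j hne
    rw [hij, sub_self, abs_zero] at this
    linarith
  -- At distance `2 * K` from `a p` the interpolation sum is below 1 in modulus: the node `a p`
  -- contributes at most 1/2, the other `n - 1` together less than 1/2 because `4 * n * K ≤ D`. So
  -- both polynomials have the same sign there.
  have hratio : ∀ x : ℝ, |x - a p| = 2 * K → 0 < (∏ q, (x - b q)) * ∏ i, (x - a i) := by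
    intro x hx
    have hfar : ∀ i, i ≠ p → D / 2 ≤ |x - a i| := by
      intro i hi
      have h1 := hsep p i (Ne.symm hi)
      have h2 : |a p - a i| ≤ |x - a i| + |x - a p| := by
        rw [abs_sub_comm x (a p)]
        have := abs_add_le (a p - x) (x - a i)
        rw [sub_add_sub_cancel] at this
        linarith
      linarith
    have hne : ∀ i, x ≠ a i := by
      intro i hi
      have h0 : |x - a i| = 0 := by rw [hi, sub_self, abs_zero]
      by_cases hip : i = p
      · subst hip; linarith
      · have := hfar i hip; linarith
    rw [prod_sub_eq_prod_sub_mul a b hinj x hne]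
    have hR : ∏ i, (x - a i) ≠ 0 := Finset.prod_ne_zero_iff.2 fun i _ => sub_ne_zero.2 (hne i)
    have hterm : ∀ i, |(∏ q, (a i - b q)) / (∏ j ∈ Finset.univ.erase i, (a i - a j)) / (x - a i)|
        ≤ K / |x - a i| := by
      intro i
      have hw : 0 < ∏ j ∈ Finset.univ.erase i, |a i - a j| := Finset.prod_pos fun j hj =>
        abs_pos.2 (sub_ne_zero.2 fun h => (Finset.ne_of_mem_erase hj) (hinj h).symm)
      rw [abs_div, abs_div, Finset.abs_prod, Finset.abs_prod]
      gcongr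
      rw [div_le_iff₀ hw]
      exact hQ i
    have hsum : |∑ i, (∏ q, (a i - b q)) / (∏ j ∈ Finset.univ.erase i, (a i - a j)) / (x - a i)|
        < 1 := by
      refine (Finset.abs_sum_le_sum_abs _ _).trans_lt ?_
      refine (Finset.sum_le_sum fun i _ => hterm i).trans_lt ?_
      rw [← Finset.add_sum_erase _ _ (Finset.mem_univ p), hx]
      have h1 : ∑ i ∈ Finset.univ.erase p, K / |x - a i| ≤
          ∑ i ∈ Finset.univ.erase p, K / (D / 2) := by
        refine Finset.sum_le_sum fun i hi => ?_
        have := hfar i (Finset.ne_of_mem_erase hi)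
        gcongr
      rw [Finset.sum_const, Finset.card_erase_of_mem (Finset.mem_univ p), Finset.card_univ,
        Fintype.card_fin, nsmul_eq_mul, Nat.cast_sub hn] at h1
      have h2 : K / (2 * K) = 1 / 2 := by field_simp
      have h3 : ((n : ℝ) - (1 : ℕ)) * (K / (D / 2)) < 1 / 2 := by
        rw [Nat.cast_one, ← mul_div_assoc, div_lt_div_iff₀ (by positivity) (by norm_num)]
        nlinarith
      linarith
    have h1 := abs_lt.1 hsum
    rw [mul_right_comm]
    exact mul_pos (mul_self_pos.2 hR) (by linarith [h1.1])
  have h1 := hratio (a p - 2 * K) (by rw [sub_sub_cancel_left, abs_neg, abs_of_pos (by linarith)])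
  have h2 := hratio (a p + 2 * K) (by rw [add_sub_cancel_left, abs_of_pos (by linarith)])
  -- Only the node `a p` lies between the two points, so the polynomial with roots `a` changes sign,
  -- and the other one with it.
  have h3 : (∏ i, (a p - 2 * K - a i)) * ∏ i, (a p + 2 * K - a i) < 0 := by
    rw [← Finset.prod_mul_distrib, ← Finset.mul_prod_erase _ _ (Finset.mem_univ p)]
    refine mul_neg_of_neg_of_pos (by nlinarith) (Finset.prod_pos fun i hi => ?_)
    have := hsep p i (Finset.ne_of_mem_erase hi).symm
    have h4 : D ^ 2 ≤ (a p - a i) ^ 2 := by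
      rw [← sq_abs (a p - a i)]
      gcongr
    nlinarith
  have h4 : (∏ q, (a p - 2 * K - b q)) * ∏ q, (a p + 2 * K - b q) < 0 := by
    by_contra! hcon
    nlinarith [mul_pos h1 h2, mul_nonneg hcon (neg_pos.2 h3).le]
  have hcont : Continuous fun x : ℝ => ∏ q, (x - b q) := by fun_prop
  have h0 : (0 : ℝ) ∈ Set.uIcc (∏ q, (a p - 2 * K - b q)) (∏ q, (a p + 2 * K - b q)) := by
    rw [Set.mem_uIcc]
    rcases mul_neg_iff.1 h4 with h | h
    · exact Or.inr ⟨h.2.le, h.1.le⟩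
    · exact Or.inl ⟨h.1.le, h.2.le⟩
  obtain ⟨x, hx, hx0⟩ := intermediate_value_uIcc hcont.continuousOn h0
  obtain ⟨q, -, hq⟩ := Finset.prod_eq_zero_iff.1 hx0
  rw [Set.uIcc_of_le (by linarith)] at hx
  exact ⟨q, abs_le.2 ⟨by linarith [hx.1], by linarith [hx.2]⟩⟩

/-! ### Products of distances between separated points -/

/-- A monotone family of reals with gaps at least `D`. -/
theorem mul_abs_sub_le_of_monotone {n : ℕ} (a : Fin n → ℝ) (ha : Monotone a) (D : ℝ)
    (hsep : ∀ p q, p ≠ q → D ≤ |a p - a q|) (p q : Fin n) :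
    |(p : ℝ) - q| * D ≤ |a p - a q| := by
  have main : ∀ (m : ℕ) (p q : Fin n), (q : ℕ) = p + m → (m : ℝ) * D ≤ a q - a p := by
    intro m
    induction m with
    | zero =>
      intro p q h
      rw [Fin.ext (a := q) (b := p) (by simpa using h)]
      simp
    | succ m ih =>
      intro p q h
      have hr : (p : ℕ) + m < n := by omega
      have h1 := ih p ⟨p + m, hr⟩ rfl
      have hle : (⟨p + m, hr⟩ : Fin n) < q := by rw [Fin.lt_def]; simp only; omega
      have h2 := hsep q ⟨p + m, hr⟩ hle.ne'
      rw [abs_of_nonneg (sub_nonneg.2 (ha hle.le))] at h2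
      push_cast
      linarith
  rcases le_total p q with h | h
  · have hpq : ((q - p : ℕ) : ℝ) = q - p := Nat.cast_sub h
    rw [abs_sub_comm, abs_of_nonneg (by rw [← hpq]; positivity), ← hpq, abs_sub_comm,
      abs_of_nonneg (sub_nonneg.2 (ha h))]
    exact main _ p q (by rw [Fin.le_def] at h; omega)
  · have hpq : ((p - q : ℕ) : ℝ) = p - q := Nat.cast_sub h
    rw [abs_of_nonneg (by rw [← hpq]; positivity), ← hpq, abs_of_nonneg (sub_nonneg.2 (ha h))]
    exact main _ q p (by rw [Fin.le_def] at h; omega)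

/-- The distances from `p` to the integers below it are `1, …, p`, and to those above it `1, …, n -
p`. -/
theorem prod_abs_sub_succAbove {n : ℕ} (p : Fin (n + 1)) :
    ∏ i : Fin n, |((p : ℕ) : ℝ) - ((p.succAbove i : Fin (n + 1)) : ℕ)| =
      ((p : ℕ).factorial * (n - p).factorial : ℕ) := by
  obtain ⟨m, hm⟩ : ∃ m, n = p + m := ⟨n - p, by omega⟩
  have hg : ∀ i : Fin n, |((p : ℕ) : ℝ) - ((p.succAbove i : Fin (n + 1)) : ℕ)| =
      (fun i : ℕ => ((if i < p then p - i else i + 1 - p : ℕ) : ℝ)) i := by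
    intro i
    simp only
    split_ifs with h
    · rw [Fin.succAbove_of_castSucc_lt _ _ (by rw [Fin.lt_def]; simpa using h), Fin.val_castSucc,
        Nat.cast_sub h.le, abs_of_nonneg (sub_nonneg.2 (by exact_mod_cast h.le))]
    · push Not at h
      rw [Fin.succAbove_of_le_castSucc _ _ (by rw [Fin.le_def]; simpa using h), Fin.val_succ,
        Nat.cast_sub (by omega), abs_sub_comm,
        abs_of_nonneg (sub_nonneg.2 (by exact_mod_cast (by omega)))]
  rw [Finset.prod_congr rfl fun i _ => hg i,
    Fin.prod_univ_eq_prod_range (fun i : ℕ => ((if i < p then p - i else i + 1 - p : ℕ) : ℝ)),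
    ← Nat.cast_prod]
  congr 1
  generalize (p : ℕ) = k at hm
  subst hm
  rw [Finset.prod_range_add, Nat.add_sub_cancel_left, ← Finset.prod_range_add_one_eq_factorial k,
    ← Finset.prod_range_add_one_eq_factorial m, ← Finset.prod_range_reflect]
  congr 1
  · refine Finset.prod_congr rfl fun i hi => ?_
    rw [Finset.mem_range] at hi
    rw [if_pos (by omega)]
    omega
  · refine Finset.prod_congr rfl fun i hi => ?_
    rw [if_neg (by omega)]
    omega

/-- The product of the distances from one of `n` points of the line with gaps at least `D` to the
others. -/
theorem le_prod_abs_sub_of_separated {n : ℕ} (a : Fin n → ℝ) (D : ℝ) (hD : 0 ≤ D)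
    (hsep : ∀ p q, p ≠ q → D ≤ |a p - a q|) (p : Fin n) :
    ((n - 1).factorial : ℝ) / 2 ^ (n - 1) * D ^ (n - 1) ≤
      ∏ j ∈ Finset.univ.erase p, |a p - a j| := by
  obtain ⟨n, rfl⟩ : ∃ m, n = m + 1 := ⟨n - 1, by have := p.pos; omega⟩
  have hmono := Tuple.monotone_sort a
  set s := Tuple.sort a
  obtain ⟨p, rfl⟩ := s.surjective p
  have e : ∏ j ∈ Finset.univ.erase (s p), |a (s p) - a j| =
      ∏ i : Fin n, |(a ∘ s) p - (a ∘ s) (p.succAbove i)| := by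
    have h1 : Finset.univ.erase (s p) =
        (Finset.univ : Finset (Fin n)).map ⟨fun i => s (p.succAbove i),
          s.injective.comp p.succAbove_right_injective⟩ := by
      ext j
      obtain ⟨j, rfl⟩ := s.surjective j
      simp [Fin.exists_succAbove_eq_iff]
    rw [h1, Finset.prod_map]
    rfl
  rw [e, Nat.add_sub_cancel]
  have hsep' : ∀ p q, p ≠ q → D ≤ |(a ∘ s) p - (a ∘ s) q| := fun p q h =>
    hsep _ _ (s.injective.ne h)
  -- After sorting, the product is at least `p! (n - p)! D ^ n`, and a binomial coefficient is at
  -- most `2 ^ n`.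
  calc ((n.factorial : ℝ) / 2 ^ n) * D ^ n
      ≤ ((p : ℕ).factorial * (n - p).factorial : ℕ) * D ^ n := by
        gcongr
        rw [div_le_iff₀ (by positivity)]
        have h1 := Nat.choose_mul_factorial_mul_factorial (show (p : ℕ) ≤ n by omega)
        have h2 := Nat.choose_le_two_pow n p
        rw [← h1]
        norm_cast
        rw [mul_assoc, mul_comm]
        gcongr
    _ = ∏ i : Fin n, |((p : ℕ) : ℝ) - ((p.succAbove i : Fin (n + 1)) : ℕ)| * D := by
        rw [← prod_abs_sub_succAbove, Finset.prod_mul_distrib, Finset.prod_const]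
        simp
    _ ≤ _ := Finset.prod_le_prod (fun i _ => by positivity) fun i _ =>
        mul_abs_sub_le_of_monotone _ hmono D hsep' _ _

/-! ### From exponential sums to distances between locations -/

/-- The chord is `2 |sin ((x - y) / 2)|`; Jordan's inequality bounds the sine from below. -/
theorem two_div_pi_mul_abs_le_norm_exp_sub_exp (x y : ℝ) (h : |x - y| ≤ Real.pi) :
    2 / Real.pi * |x - y| ≤
      ‖Complex.exp (Complex.I * (x : ℂ)) - Complex.exp (Complex.I * (y : ℂ))‖ := by
  have e : Complex.exp (Complex.I * (x : ℂ)) - Complex.exp (Complex.I * (y : ℂ)) =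
      Complex.exp (Complex.I * (y : ℂ)) * (Complex.exp (Complex.I * ((x - y : ℝ) : ℂ)) - 1) := by
    rw [mul_sub, ← Complex.exp_add, mul_one]
    congr 2
    push_cast
    ring
  have h1 : ‖Complex.exp (Complex.I * (y : ℂ))‖ = 1 := by
    rw [mul_comm]; exact Complex.norm_exp_ofReal_mul_I y
  rw [e, norm_mul, h1, one_mul, Complex.norm_exp_I_mul_ofReal_sub_one, Real.norm_eq_abs, abs_mul,
    abs_two]
  have h2 := Real.mul_abs_le_abs_sin (x := (x - y) / 2) (by
    rw [abs_div, abs_two]; linarith)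
  rw [abs_div, abs_two] at h2
  linarith

/-- Two exponential sums on `[-Ω, Ω]` at distance at most `M`: the product of the distances from a
location of the first to all the other locations is small. -/
theorem norm_mul_prod_dist_le {n : ℕ} (hn : 1 ≤ n) (Ω M : ℝ) (hΩ : 0 < Ω) (a b : Fin n → ℂ)
    (y z : Fin n → ℝ) (hy : ∀ j, |y j| ≤ ((n : ℝ) - 1) * Real.pi / (2 * Ω))
    (hz : ∀ j, |z j| ≤ ((n : ℝ) - 1) * Real.pi / (2 * Ω))
    (h : ∀ t : ℝ, |t| ≤ Ω → ‖∑ j, b j * Complex.exp (Complex.I * ((z j * t : ℝ) : ℂ)) -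
      ∑ j, a j * Complex.exp (Complex.I * ((y j * t : ℝ) : ℂ))‖ ≤ M) (p : Fin n) :
    (4 * Ω / (Real.pi * (2 * n - 1))) ^ (2 * n - 1) * (‖a p‖ * ((∏ q, |y p - z q|) *
      ∏ j ∈ Finset.univ.erase p, |y p - y j|)) ≤ 2 ^ (2 * n - 1) * M := by
  have hn' : (1 : ℝ) ≤ n := by exact_mod_cast hn
  have hpi := Real.pi_pos
  -- The spacing of `2 * n` samples running from `-Ω` to `Ω`.
  set η : ℝ := 2 * Ω / (2 * n - 1) with hη
  have hηpos : 0 < η := div_pos (by linarith) (by linarith)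
  set x : Fin n ⊕ Fin n → ℝ := Sum.elim z y with hx
  have hxb : ∀ i, |x i| ≤ ((n : ℝ) - 1) * Real.pi / (2 * Ω) := by
    rintro (i | i)
    · exact hz i
    · exact hy i
  -- The phase factor makes the exponent `t = 0` correspond to the frequency `-Ω`.
  set c : Fin n ⊕ Fin n → ℂ := fun i => Sum.elim b (-a) i *
    Complex.exp (Complex.I * ((-(x i * Ω) : ℝ) : ℂ)) with hc
  have hnorm : ∀ u : ℝ, ‖Complex.exp (Complex.I * (u : ℂ))‖ = 1 := fun u => by
    rw [mul_comm]; exact Complex.norm_exp_ofReal_mul_I u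
  have key := norm_mul_prod_sub_le (fun i => Complex.exp (Complex.I * ((η * x i : ℝ) : ℂ))) c
    (fun i => (hnorm _).le) M (fun t ht => by
      rw [Fintype.card_sum, Fintype.card_fin] at ht
      have ht' : (t : ℝ) ≤ 2 * n - 1 := by
        have : t + 1 ≤ 2 * n := by omega
        have : ((t + 1 : ℕ) : ℝ) ≤ ((2 * n : ℕ) : ℝ) := by exact_mod_cast this
        push_cast at this
        linarith
      have hω : |-Ω + t * η| ≤ Ω := by
        have h1 : t * η ≤ 2 * Ω := by
          rw [hη, ← mul_div_assoc, div_le_iff₀ (by linarith)]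
          nlinarith
        have h2 : 0 ≤ t * η := by positivity
        exact abs_le.2 ⟨by linarith, by linarith⟩
      refine le_of_eq_of_le (congrArg norm ?_) (h _ hω)
      have e : ∀ i, c i * Complex.exp (Complex.I * ((η * x i : ℝ) : ℂ)) ^ t =
          Sum.elim b (-a) i * Complex.exp (Complex.I * ((x i * (-Ω + t * η) : ℝ) : ℂ)) := by
        intro i
        rw [hc, ← Complex.exp_nat_mul, mul_assoc, ← Complex.exp_add]
        congr 2
        push_cast
        ring
      rw [Finset.sum_congr rfl fun i _ => e i, Fintype.sum_sum_type, sub_eq_add_neg,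
        ← Finset.sum_neg_distrib]
      simp [hx]) (Sum.inr p)
  have hcp : ‖c (Sum.inr p)‖ = ‖a p‖ := by
    rw [hc]
    simp only [Sum.elim_inr, Pi.neg_apply]
    rw [norm_mul, hnorm, norm_neg, mul_one]
  have hdist : ∀ i l, 4 * Ω / (Real.pi * (2 * n - 1)) * |x i - x l| ≤
      ‖Complex.exp (Complex.I * ((η * x i : ℝ) : ℂ)) -
        Complex.exp (Complex.I * ((η * x l : ℝ) : ℂ))‖ := by
    intro i l
    have h1 := abs_sub (x i) (x l)
    have h2 := hxb i
    have h3 := hxb l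
    have h4 : |η * x i - η * x l| = η * |x i - x l| := by
      rw [← mul_sub, abs_mul, abs_of_pos hηpos]
    -- The support radius is what keeps the phase differences within the range of Jordan's
    -- inequality.
    have h5 : η * |x i - x l| ≤ Real.pi := by
      calc η * |x i - x l| ≤ η * (2 * (((n : ℝ) - 1) * Real.pi / (2 * Ω))) := by
            gcongr; linarith
        _ = (2 * n - 2) / (2 * n - 1) * Real.pi := by rw [hη]; field_simp
        _ ≤ 1 * Real.pi := by
            gcongr
            rw [div_le_one (by linarith)]
            linarith
        _ = Real.pi := one_mul _
    refine le_trans (le_of_eq ?_) (two_div_pi_mul_abs_le_norm_exp_sub_exp _ _ (h4 ▸ h5))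
    have : (2 * n - 1 : ℝ) ≠ 0 := by linarith
    rw [h4, hη]
    field_simp
    ring
  rw [hcp, Fintype.card_sum, Fintype.card_fin, ← two_mul] at key
  refine le_trans (le_of_eq_of_le ?_ (mul_le_mul_of_nonneg_left (Finset.prod_le_prod
    (fun l _ => ?_) fun l _ => hdist (Sum.inr p) l) (norm_nonneg _))) key
  · rw [Finset.prod_mul_distrib, Finset.prod_const, Finset.card_erase_of_mem (Finset.mem_univ _),
      Finset.card_univ, Fintype.card_sum, Fintype.card_fin, ← two_mul]
    have e : (Finset.univ.erase (Sum.inr p) : Finset (Fin n ⊕ Fin n)) =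
        Finset.univ.disjSum (Finset.univ.erase p) := by
      ext (i | i) <;> simp
    rw [e, Finset.prod_disjSum]
    simp only [hx, Sum.elim_inl, Sum.elim_inr]
    ring
  · have : (0 : ℝ) < 2 * n - 1 := by linarith
    positivity

/-! ### Numerical inequalities behind the constants -/

/-- A substitute for Stirling's formula. Bernoulli's inequality `(1 + 1/(2n-1))^(2n-1) ≥ 2` bounds
the left side by `n^(2n-1)`, and `n^n / n! ≤ e^n` gives `n^(n-1) ≤ e^n (n-1)!`, which is squared. -/
theorem two_mul_sub_half_pow_le (n : ℕ) (hn : 1 ≤ n) :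
    2 * ((2 * n - 1) / 2 : ℝ) ^ (2 * n - 1) ≤
      n * Real.exp (2 * n) * ((n - 1).factorial : ℝ) ^ 2 := by
  obtain ⟨k, rfl⟩ : ∃ k, n = k + 1 := ⟨n - 1, by omega⟩
  rw [show 2 * (k + 1) - 1 = 2 * k + 1 by omega, Nat.add_sub_cancel]
  have hk : (0 : ℝ) < 2 * k + 1 := by positivity
  have h1 : 2 * ((2 * ((k + 1 : ℕ) : ℝ) - 1) / 2) ^ (2 * k + 1) ≤ ((k : ℝ) + 1) ^ (2 * k + 1) := by
    have hB := one_add_mul_le_pow (a := 1 / (2 * k + 1 : ℝ)) (by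
      have : 0 < 1 / (2 * k + 1 : ℝ) := by positivity
      linarith) (2 * k + 1)
    have e : (k : ℝ) + 1 = (2 * ((k + 1 : ℕ) : ℝ) - 1) / 2 * (1 + 1 / (2 * k + 1 : ℝ)) := by
      push_cast; field_simp; ring
    rw [e, mul_pow, mul_comm]
    gcongr
    · exact pow_nonneg (by push_cast; linarith) _
    · refine le_trans (le_of_eq ?_) hB
      push_cast; field_simp; ring
  have h2 := Real.pow_div_factorial_le_exp (x := (k : ℝ) + 1) (by positivity) (k + 1)
  rw [div_le_iff₀ (by positivity), Nat.factorial_succ, pow_succ] at h2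
  push_cast at h2
  have h3 : ((k : ℝ) + 1) ^ k ≤ Real.exp (k + 1) * k.factorial := by
    have : (0 : ℝ) < k + 1 := by positivity
    nlinarith
  calc _ ≤ ((k : ℝ) + 1) ^ (2 * k + 1) := h1
    _ = (k + 1) * (((k : ℝ) + 1) ^ k) ^ 2 := by ring
    _ ≤ (k + 1) * (Real.exp (k + 1) * k.factorial) ^ 2 := by gcongr
    _ = _ := by
      rw [mul_pow, ← Real.exp_nat_mul]
      push_cast
      ring

/-- Makes the separation constant `5.88 = 2 · 2.94` sufficient for `4 * n * K ≤ D` in the root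
argument. -/
theorem two_mul_sq_mul_exp_one_le (n : ℕ) (hn : 2 ≤ n) :
    2 * (n : ℝ) ^ 2 * Real.exp 1 ≤ 2.94 ^ (2 * n - 1) := by
  induction n, hn using Nat.le_induction with
  | base => norm_num; linarith [Real.exp_one_lt_d9]
  | succ n hn ih =>
    have hn' : (2 : ℝ) ≤ n := by exact_mod_cast hn
    have h1 : (2.94 : ℝ) ^ (2 * (n + 1) - 1) = 2.94 ^ (2 * n - 1) * 2.94 ^ 2 := by
      rw [← pow_add]; congr 1; omega
    rw [h1]
    have h2 : ((n + 1 : ℕ) : ℝ) ^ 2 ≤ n ^ 2 * 2.94 ^ 2 := by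
      push_cast
      nlinarith
    calc 2 * ((n + 1 : ℕ) : ℝ) ^ 2 * Real.exp 1 ≤ 2 * (n ^ 2 * 2.94 ^ 2) * Real.exp 1 := by gcongr
      _ = 2 * (n : ℝ) ^ 2 * Real.exp 1 * 2.94 ^ 2 := by ring
      _ ≤ _ := by gcongr

/-- Passes from the constant that the root argument yields to the one in the theorem; it amounts to
`π^(3/2) ≤ 2^(2n-1)`, whose right side is at least 8. -/
theorem pi_mul_two_pow_le (n : ℕ) (hn : 2 ≤ n) :
    Real.pi * 2 ^ (2 * n - 1) ≤ 2 ^ (4 * n - 2) * Real.pi ^ (-(1 / 2) : ℝ) := by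
  have h1 : (1 / 2 : ℝ) ≤ Real.pi ^ (-(1 / 2) : ℝ) := by
    calc (1 / 2 : ℝ) = (4 : ℝ) ^ (-(1 / 2) : ℝ) := by
          rw [show (4 : ℝ) = 2 ^ (2 : ℝ) by norm_num, ← Real.rpow_mul (by norm_num)]
          norm_num [Real.rpow_neg_one]
      _ ≤ _ := Real.rpow_le_rpow_of_nonpos Real.pi_pos Real.pi_le_four (by norm_num)
  have h2 : (2 : ℝ) ^ (4 * n - 2) = 2 ^ (2 * n - 1) * 2 ^ (2 * n - 1) := by
    rw [← pow_add]; congr 1; omega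
  have h3 : (2 : ℝ) ^ 3 ≤ 2 ^ (2 * n - 1) := pow_le_pow_right₀ (by norm_num) (by omega)
  have h4 := Real.pi_le_four
  rw [h2, mul_comm, mul_assoc]
  gcongr
  nlinarith

/-! ### The one-dimensional theorem -/

/-- Stability of the locations on the line. -/
theorem exists_location_near {n : ℕ} (hn : 2 ≤ n) (Ω σ m D : ℝ) (hΩ : 0 < Ω) (hσ : 0 < σ)
    (hm : 0 < m) (hD : 0 < D) (a b : Fin n → ℂ) (ha : ∀ j, m ≤ ‖a j‖)
    (y z : Fin n → ℝ) (hy : ∀ j, |y j| ≤ ((n : ℝ) - 1) * Real.pi / (2 * Ω))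
    (hz : ∀ j, |z j| ≤ ((n : ℝ) - 1) * Real.pi / (2 * Ω))
    (h : ∀ t : ℝ, |t| ≤ Ω → ‖∑ j, b j * Complex.exp (Complex.I * ((z j * t : ℝ) : ℂ)) -
      ∑ j, a j * Complex.exp (Complex.I * ((y j * t : ℝ) : ℂ))‖ ≤ 2 * σ)
    (hsep : ∀ p q, p ≠ q → D ≤ |y p - y q|)
    (hDσ : (5.88 * Real.pi * Real.exp 1 / Ω) ^ (2 * n - 1) * (σ / m) ≤ D ^ (2 * n - 1))
    (p : Fin n) :
    ∃ q, |z q - y p| < D / 2 ∧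
      |z q - y p| ≤ n * 2 ^ (4 * n - 2) * Real.exp (2 * n) * Real.pi ^ (-(1 / 2) : ℝ) / Ω *
        (Real.pi / (Ω * D)) ^ (2 * n - 2) * (σ / m) := by
  have hn' : (2 : ℝ) ≤ n := by exact_mod_cast hn
  have hpi := Real.pi_pos
  set c : ℝ := 4 * Ω / (Real.pi * (2 * n - 1)) with hc
  have hcpos : 0 < c := div_pos (by positivity) (mul_pos hpi (by linarith))
  set W : ℝ := ((n - 1).factorial : ℝ) / 2 ^ (n - 1) * D ^ (n - 1) with hW
  have hWpos : 0 < W := by positivity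
  set B : ℝ := 4 ^ n * (σ / m) / c ^ (2 * n - 1) with hB
  have hBpos : 0 < B := by positivity
  have hWle := le_prod_abs_sub_of_separated y D hD.le hsep
  have hprod : ∀ p, (∏ q, |y p - z q|) * ∏ j ∈ Finset.univ.erase p, |y p - y j| ≤ B := by
    intro p
    have key := norm_mul_prod_dist_le (by omega) Ω (2 * σ) hΩ a b y z hy hz h p
    have hnn : 0 ≤ (∏ q, |y p - z q|) * ∏ j ∈ Finset.univ.erase p, |y p - y j| := by positivity
    have h4 : (2 : ℝ) ^ (2 * n - 1) * (2 * σ) = 4 ^ n * σ := by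
      rw [← mul_assoc, ← pow_succ, show 2 * n - 1 + 1 = 2 * n by omega, pow_mul]
      norm_num
    rw [h4, ← hc] at key
    rw [hB, le_div_iff₀ (by positivity), ← mul_div_assoc, le_div_iff₀ hm]
    refine le_trans ?_ key
    calc _ = c ^ (2 * n - 1) * (m * ((∏ q, |y p - z q|) *
          ∏ j ∈ Finset.univ.erase p, |y p - y j|)) := by ring
      _ ≤ _ := by gcongr; exact ha p
  -- If `w ≥ W` is the product of the distances from `y p` to the other `y j`, then `B / w = (B / w
  -- ^ 2) * w ≤ K * w`, the form that the root argument needs.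
  set K : ℝ := B / W ^ 2 with hK
  have hKpos : 0 < K := by positivity
  have hD1 : D ^ (2 * n - 1) = D * D ^ (2 * n - 2) := by
    rw [← pow_succ']; congr 1; omega
  have hKle : 2 * K ≤ (2 * Real.pi / Ω) ^ (2 * n - 1) * (n * Real.exp (2 * n)) * (σ / m) /
      D ^ (2 * n - 2) := by
    have h1 := two_mul_sub_half_pow_le n (by omega)
    have h2 : W ^ 2 = ((n - 1).factorial : ℝ) ^ 2 / 4 ^ (n - 1) * D ^ (2 * n - 2) := by
      rw [hW, mul_pow, div_pow, ← pow_mul, ← pow_mul, mul_comm (n - 1) 2, pow_mul (2 : ℝ) 2,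
        show 2 * (n - 1) = 2 * n - 2 by omega]
      norm_num
    have h3 : (1 / c) ^ (2 * n - 1) * (4 ^ n * 4 ^ (n - 1)) =
        (2 * Real.pi / Ω) ^ (2 * n - 1) * ((2 * n - 1) / 2) ^ (2 * n - 1) := by
      rw [← pow_add, show n + (n - 1) = 2 * n - 1 by omega, ← mul_pow, ← mul_pow]
      congr 1
      have : (2 * n - 1 : ℝ) ≠ 0 := by linarith
      rw [hc]
      field_simp
    have h4 : 2 * K = ((1 / c) ^ (2 * n - 1) * (4 ^ n * 4 ^ (n - 1))) * 2 * (σ / m) /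
        ((n - 1).factorial : ℝ) ^ 2 / D ^ (2 * n - 2) := by
      rw [hK, hB, h2, one_div, inv_pow]
      field_simp
    rw [h4, h3]
    gcongr
    rw [div_le_iff₀ (by positivity)]
    calc _ = (2 * Real.pi / Ω) ^ (2 * n - 1) * (σ / m) *
          (2 * ((2 * n - 1) / 2 : ℝ) ^ (2 * n - 1)) := by ring
      _ ≤ (2 * Real.pi / Ω) ^ (2 * n - 1) * (σ / m) *
          (n * Real.exp (2 * n) * ((n - 1).factorial : ℝ) ^ 2) := by gcongr
      _ = _ := by ring
  have hKD : 4 * n * K ≤ D := by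
    have h1 := two_mul_sq_mul_exp_one_le n hn
    have h2 : (5.88 * Real.pi * Real.exp 1 / Ω) ^ (2 * n - 1) =
        (2 * Real.pi / Ω) ^ (2 * n - 1) * (2.94 ^ (2 * n - 1) * Real.exp 1 ^ (2 * n - 1)) := by
      rw [← mul_pow, ← mul_pow]
      congr 1
      ring
    have h3 : Real.exp (2 * n) = Real.exp 1 * Real.exp 1 ^ (2 * n - 1) := by
      rw [← pow_succ', ← Real.exp_nat_mul, show 2 * n - 1 + 1 = 2 * n by omega]
      push_cast
      ring_nf
    calc 4 * n * K = 2 * n * (2 * K) := by ring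
      _ ≤ 2 * n * ((2 * Real.pi / Ω) ^ (2 * n - 1) * (n * Real.exp (2 * n)) * (σ / m) /
          D ^ (2 * n - 2)) := by gcongr
      _ = (2 * Real.pi / Ω) ^ (2 * n - 1) * (2 * (n : ℝ) ^ 2 * Real.exp 1 *
          Real.exp 1 ^ (2 * n - 1)) * (σ / m) / D ^ (2 * n - 2) := by rw [h3]; ring
      _ ≤ (2 * Real.pi / Ω) ^ (2 * n - 1) * (2.94 ^ (2 * n - 1) *
          Real.exp 1 ^ (2 * n - 1)) * (σ / m) / D ^ (2 * n - 2) := by gcongr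
      _ ≤ D := by
        rw [div_le_iff₀ (by positivity), ← h2, ← hD1]
        exact hDσ
  obtain ⟨q, hq⟩ := exists_root_near_node (by omega) y z D K hKpos hsep hKD (fun p => by
    have hw := hWle p
    have hw0 := hWpos.trans_le hw
    calc _ ≤ B / ∏ j ∈ Finset.univ.erase p, |y p - y j| := by
          rw [le_div_iff₀ hw0]; exact hprod p
      _ = B / (∏ j ∈ Finset.univ.erase p, |y p - y j|) ^ 2 *
          ∏ j ∈ Finset.univ.erase p, |y p - y j| := by field_simp
      _ ≤ _ := by rw [hK]; gcongr) p
  refine ⟨q, by nlinarith, (hq.trans hKle).trans ?_⟩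
  have h1 := pi_mul_two_pow_le n hn
  calc _ = Real.pi * 2 ^ (2 * n - 1) * (n * Real.exp (2 * n) / Ω *
        (Real.pi / (Ω * D)) ^ (2 * n - 2) * (σ / m)) := by
        have e : ∀ x : ℝ, x ^ (2 * n - 1) = x * x ^ (2 * n - 2) := fun x => by
          rw [← pow_succ']; congr 1; omega
        rw [e (2 * Real.pi / Ω), e 2]
        simp only [div_pow, mul_pow]
        field_simp
    _ ≤ 2 ^ (4 * n - 2) * Real.pi ^ (-(1 / 2) : ℝ) * (n * Real.exp (2 * n) / Ω *
        (Real.pi / (Ω * D)) ^ (2 * n - 2) * (σ / m)) := by gcongr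
    _ = _ := by ring
-- A direction that shortens no given vector too much
open MeasureTheory in
/-- The volume of the part of the cube `[-1, 1]ᵏ` in a slab. -/
theorem volume_cube_inter_slab_le {k : ℕ} (v : Fin (k + 1) → ℝ) (r : ℝ) (j : Fin (k + 1))
    (hj : v j ≠ 0) :
    volume {x : Fin (k + 1) → ℝ | (∀ i, x i ∈ Set.Icc (-1 : ℝ) 1) ∧ |∑ i, v i * x i| < r} ≤
      2 ^ k * ENNReal.ofReal (2 * r / |v j|) := by
  set f := MeasurableEquiv.piFinSuccAbove (fun _ : Fin (k + 1) => ℝ) j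
  set C : Set (Fin k → ℝ) := Set.Icc (fun _ => -1) (fun _ => 1)
  set T : Set (ℝ × (Fin k → ℝ)) :=
    {q | q.2 ∈ C ∧ |v j * q.1 + ∑ i, v (j.succAbove i) * q.2 i| < r}
  have hT : MeasurableSet T := by
    have h1 : MeasurableSet C := measurableSet_Icc
    have h2 : Measurable fun q : ℝ × (Fin k → ℝ) =>
        |v j * q.1 + ∑ i, v (j.succAbove i) * q.2 i| := by fun_prop
    exact (measurable_snd h1).inter (measurableSet_lt h2 measurable_const)
  have hsub : {x : Fin (k + 1) → ℝ | (∀ i, x i ∈ Set.Icc (-1 : ℝ) 1) ∧ |∑ i, v i * x i| < r} ⊆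
      f ⁻¹' T := by
    rintro x ⟨h1, h2⟩
    refine ⟨⟨fun i => (h1 _).1, fun i => (h1 _).2⟩, ?_⟩
    rw [Fin.sum_univ_succAbove _ j] at h2
    exact h2
  refine (measure_mono hsub).trans ?_
  have hf : MeasurePreserving f volume volume :=
    volume_preserving_piFinSuccAbove (fun _ : Fin (k + 1) => ℝ) j
  rw [hf.measure_preimage hT.nullMeasurableSet, Measure.volume_eq_prod, Measure.prod_apply_symm hT]
  have hvol : volume C = 2 ^ k := by
    rw [Real.volume_Icc_pi]
    norm_num
  calc ∫⁻ y, volume ((fun t => (t, y)) ⁻¹' T)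
      ≤ ∫⁻ y, C.indicator (fun _ => ENNReal.ofReal (2 * r / |v j|)) y := by
        refine lintegral_mono fun y => ?_
        by_cases hy : y ∈ C
        · rw [Set.indicator_of_mem hy]
          set s := ∑ i, v (j.succAbove i) * y i with hs
          have hj' : 0 < |v j| := abs_pos.2 hj
          -- With the other coordinates fixed, the slab confines coordinate `j` to an interval of
          -- length `2 * r / |v j|`.
          have : (fun t => (t, y)) ⁻¹' T ⊆ Metric.ball (-s / v j) (r / |v j|) := by
            rintro t ⟨-, ht⟩
            rw [Metric.mem_ball, Real.dist_eq, lt_div_iff₀ hj', ← abs_mul]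
            refine lt_of_eq_of_lt (congrArg abs ?_) ht
            simp only
            rw [← hs]
            field_simp
            ring
          refine (measure_mono this).trans ?_
          rw [Real.volume_ball, mul_div_assoc]
        · rw [Set.indicator_of_notMem hy]
          have : (fun t => (t, y)) ⁻¹' T = ∅ := by
            ext t; simp [T, hy]
          rw [this, measure_empty]
    _ = 2 ^ k * ENNReal.ofReal (2 * r / |v j|) := by
        rw [lintegral_indicator_const measurableSet_Icc, hvol, mul_comm]

theorem exists_norm_le_sqrt_mul_abs {k : ℕ} (v : E (k + 1)) :
    ∃ j, ‖v‖ ≤ √((k : ℝ) + 1) * |v j| := by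
  obtain ⟨j, -, hj⟩ := Finset.exists_max_image Finset.univ (fun j => |v j|) Finset.univ_nonempty
  refine ⟨j, ?_⟩
  rw [EuclideanSpace.norm_eq, ← Real.sqrt_sq (abs_nonneg (v j)),
    ← Real.sqrt_mul (by positivity)]
  refine Real.sqrt_le_sqrt ?_
  calc ∑ i, ‖v i‖ ^ 2 ≤ ∑ _i : Fin (k + 1), |v j| ^ 2 := by
        refine Finset.sum_le_sum fun i _ => ?_
        rw [Real.norm_eq_abs]
        exact pow_le_pow_left₀ (abs_nonneg _) (hj i (Finset.mem_univ i)) 2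
    _ = _ := by simp

theorem exists_norm_eq_one (k : ℕ) : ∃ w : E (k + 1), ‖w‖ = 1 :=
  ⟨EuclideanSpace.single 0 1, by simp⟩

open MeasureTheory in
/-- A direction nearly orthogonal to none of finitely many vectors. -/
theorem exists_direction {ι : Type*} [Fintype ι] {k : ℕ} (u : ι → E (k + 1)) (F : ℝ)
    (hF : (Fintype.card ι : ℝ) * (k + 1) < F) :
    ∃ w : E (k + 1), ‖w‖ = 1 ∧ ∀ i, ‖u i‖ ≤ F * |inner ℝ (u i) w| := by
  have hF0 : 0 < F := lt_of_le_of_lt (by positivity) hF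
  set ρ : ℝ := √((k : ℝ) + 1) with hρ
  have hρpos : 0 < ρ := Real.sqrt_pos.2 (by positivity)
  have hρsq : ρ ^ 2 = k + 1 := Real.sq_sqrt (by positivity)
  -- Slicing along the largest coordinate of `u i`, at least `‖u i‖ / ρ` in modulus, shows that each
  -- slab fills at most a fraction `(k + 1) / F` of the cube. The factor `ρ` bounds the norm of a
  -- point of the cube and cancels on normalizing.
  set bad : ι → Set (Fin (k + 1) → ℝ) := fun i =>
    {x | (∀ l, x l ∈ Set.Icc (-1 : ℝ) 1) ∧ |∑ l, u i l * x l| < ρ * ‖u i‖ / F}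
  have hbad : ∀ i, volume (bad i) ≤ 2 ^ (k + 1) * ENNReal.ofReal ((k + 1) / F) := by
    intro i
    obtain ⟨j, hj⟩ := exists_norm_le_sqrt_mul_abs (u i)
    by_cases h0 : u i = 0
    · have : bad i = ∅ := by
        ext x
        simp [bad, h0]
      rw [this, measure_empty]
      exact zero_le
    have hj0 : u i j ≠ 0 := fun h => by
      rw [h, abs_zero, mul_zero] at hj
      exact h0 (norm_le_zero_iff.1 hj)
    refine (volume_cube_inter_slab_le (fun l => u i l) _ j hj0).trans ?_
    rw [pow_succ, mul_assoc]
    gcongr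
    have h2 : (2 : ENNReal) * ENNReal.ofReal ((k + 1) / F) = ENNReal.ofReal (2 * ((k + 1) / F)) := by
      rw [ENNReal.ofReal_mul (by norm_num), ENNReal.ofReal_ofNat]
    rw [h2]
    refine ENNReal.ofReal_le_ofReal ?_
    rw [mul_div_assoc]
    refine mul_le_mul_of_nonneg_left ?_ zero_le_two
    rw [div_le_iff₀ (abs_pos.2 hj0), ← hρsq, div_mul_eq_mul_div, sq, mul_assoc]
    gcongr
  have hcube : volume (Set.Icc (fun _ => -1) (fun _ => 1) : Set (Fin (k + 1) → ℝ)) =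
      2 ^ (k + 1) := by
    rw [Real.volume_Icc_pi]
    norm_num
  have hunion : volume (⋃ i, bad i) <
      volume (Set.Icc (fun _ => -1) (fun _ => 1) : Set (Fin (k + 1) → ℝ)) := by
    rw [hcube]
    calc volume (⋃ i, bad i) ≤ ∑ i, volume (bad i) := measure_iUnion_fintype_le _ _
      _ ≤ ∑ _i : ι, 2 ^ (k + 1) * ENNReal.ofReal ((k + 1) / F) :=
        Finset.sum_le_sum fun i _ => hbad i
      _ = 2 ^ (k + 1) * ENNReal.ofReal (Fintype.card ι * ((k + 1) / F)) := by
        rw [Finset.sum_const, Finset.card_univ, nsmul_eq_mul,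
          ENNReal.ofReal_mul (by positivity), ENNReal.ofReal_natCast]
        ring
      _ < 2 ^ (k + 1) * 1 := by
        refine (ENNReal.mul_lt_mul_iff_right (by simp) (by simp)).2 ?_
        rw [ENNReal.ofReal_lt_one, ← mul_div_assoc, div_lt_one hF0]
        exact hF
      _ = 2 ^ (k + 1) := mul_one _
  obtain ⟨x, hx, hxb⟩ : ∃ x ∈ (Set.Icc (fun _ => -1) (fun _ => 1) : Set (Fin (k + 1) → ℝ)),
      x ∉ ⋃ i, bad i := by
    by_contra! hcon
    exact absurd (measure_mono hcon) (not_le.2 hunion)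
  have hgood : ∀ i, ρ * ‖u i‖ ≤ F * |∑ l, u i l * x l| := by
    intro i
    have h1 : x ∉ bad i := fun h => hxb (Set.mem_iUnion.2 ⟨i, h⟩)
    have h2 : ¬ |∑ l, u i l * x l| < ρ * ‖u i‖ / F := fun h =>
      h1 ⟨fun l => ⟨hx.1 l, hx.2 l⟩, h⟩
    rw [not_lt, div_le_iff₀ hF0] at h2
    linarith
  set X : E (k + 1) := WithLp.toLp 2 x with hX
  have hinner : ∀ i, inner ℝ (u i) X = ∑ l, u i l * x l := fun i => by
    rw [PiLp.inner_apply]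
    refine Finset.sum_congr rfl fun l _ => ?_
    simp [hX, mul_comm]
  have hXnorm : ‖X‖ ≤ ρ := by
    rw [EuclideanSpace.norm_eq]
    refine Real.sqrt_le_sqrt ?_
    calc ∑ l, ‖X l‖ ^ 2 ≤ ∑ _l : Fin (k + 1), (1 : ℝ) := by
          refine Finset.sum_le_sum fun l _ => ?_
          have : |x l| ≤ 1 := abs_le.2 ⟨hx.1 l, hx.2 l⟩
          rw [Real.norm_eq_abs]
          exact pow_le_one₀ (abs_nonneg _) this
      _ = _ := by simp
  -- If `X = 0`, every `u i` is zero and any unit vector will do.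
  rcases eq_or_ne X 0 with h0 | h0
  · obtain ⟨w, hw⟩ := exists_norm_eq_one k
    refine ⟨w, hw, fun i => ?_⟩
    have h1 := hgood i
    rw [← hinner, h0, inner_zero_right, abs_zero, mul_zero] at h1
    have h2 : ‖u i‖ ≤ 0 := by
      by_contra! h
      exact absurd h1 (not_le.2 (mul_pos hρpos h))
    exact h2.trans (by positivity)
  · have hXpos : 0 < ‖X‖ := norm_pos_iff.2 h0
    refine ⟨‖X‖⁻¹ • X, norm_smul_inv_norm h0, fun i => ?_⟩
    rw [inner_smul_right, abs_mul, abs_of_pos (inv_pos.2 hXpos), hinner, mul_left_comm,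
      ← div_eq_inv_mul, le_div_iff₀ hXpos]
    calc _ ≤ ‖u i‖ * ρ := by gcongr
      _ = ρ * ‖u i‖ := mul_comm _ _
      _ ≤ _ := hgood i

/-- The loss `dimFactor` allows for all the directions joining `n` points, and `n` more. -/
theorem card_mul_lt_dimFactor (k n : ℕ) (hk : 1 ≤ k) (hn : 2 ≤ n) :
    (n : ℝ) * (n + 1) / 2 * (k + 1) < dimFactor (k + 1) n := by
  have hn' : (2 : ℝ) ≤ n := by exact_mod_cast hn
  set N : ℝ := ((n : ℝ) + 2) * ((n : ℝ) - 1) / 2 with hN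
  have hN2 : 2 ≤ N := by rw [hN]; nlinarith
  have hN3 : (n : ℝ) * (n + 1) / 2 = N + 1 := by rw [hN]; ring
  have hxi : 1 ≤ xi k := by
    have := Finset.single_le_sum (f := fun j : ℕ => 1 / (j : ℝ)) (s := Finset.Icc 1 k)
      (fun i _ => by positivity) (Finset.mem_Icc.2 ⟨le_rfl, hk⟩)
    simpa [xi] using this
  have h1 : N ≤ N ^ xi k := by
    calc N = N ^ (1 : ℝ) := (Real.rpow_one N).symm
      _ ≤ _ := Real.rpow_le_rpow_of_exponent_le (by linarith) hxi
  have h2 : 2 * ((k : ℝ) + 1) ≤ 4 ^ k := by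
    have h3 : ∀ k : ℕ, 1 ≤ k → 2 * ((k : ℝ) + 1) ≤ 4 ^ k := by
      intro k hk
      induction k, hk using Nat.le_induction with
      | base => norm_num
      | succ k hk ih => rw [pow_succ]; push_cast; linarith [Nat.cast_nonneg (α := ℝ) k]
    exact h3 k hk
  -- The count is `N + 1 < 2N`; then `2(k + 1) ≤ 4 ^ k` and `N ≤ N ^ xi k`.
  rw [dimFactor, Nat.add_sub_cancel, ← hN, hN3]
  calc (N + 1) * ((k : ℝ) + 1) < 2 * N * (k + 1) := by
        gcongr; linarith
    _ = 2 * (k + 1) * N := by ring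
    _ ≤ _ := by gcongr

/-- The loss `dimFactor` is enough to project the directions joining `n` points, and `n` more,
to a line. -/
theorem exists_direction_dimFactor (k n : ℕ) (hk : 1 ≤ k) (hn : 2 ≤ n) (y : Fin n → E k)
    (x : Fin n → E k) :
    ∃ w : E k, ‖w‖ = 1 ∧ (∀ i j, ‖y i - y j‖ ≤ dimFactor k n * |inner ℝ (y i - y j) w|) ∧
      ∀ j, ‖x j‖ ≤ dimFactor k n * |inner ℝ (x j) w| := by
  obtain ⟨k, rfl⟩ : ∃ l, k = l + 1 := ⟨k - 1, by omega⟩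
  -- In dimension one `dimFactor` is 1, too small for the volume count, but there projection to a
  -- unit vector preserves norms.
  rcases Nat.eq_zero_or_pos k with rfl | hk0
  · obtain ⟨w, hw⟩ := exists_norm_eq_one 0
    have h1 : dimFactor (0 + 1) n = 1 := by simp [dimFactor, xi]
    have h2 : ∀ v : E (0 + 1), ‖v‖ ≤ dimFactor (0 + 1) n * |inner ℝ v w| := by
      intro v
      rw [h1, one_mul]
      have hw1 : |w 0| = 1 := by
        rw [EuclideanSpace.norm_eq, Fin.sum_univ_one, Real.sqrt_sq (norm_nonneg _)] at hw
        exact hw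
      rw [EuclideanSpace.norm_eq, Fin.sum_univ_one, Real.sqrt_sq (norm_nonneg _), PiLp.inner_apply,
        Fin.sum_univ_one]
      simp [abs_mul, hw1]
    exact ⟨w, hw, fun _ _ => h2 _, fun _ => h2 _⟩
  · obtain ⟨w, hw, h⟩ := exists_direction (ι := (Σ i : Fin n, Fin i) ⊕ Fin n)
      (Sum.elim (fun q => y q.1 - y (q.2.castLE q.1.2.le)) x) (dimFactor (k + 1) n) (by
        refine lt_of_eq_of_lt ?_ (card_mul_lt_dimFactor k n hk0 hn)
        congr 1
        have hs : (∑ i : Fin n, (i : ℕ)) * 2 = n * (n - 1) := by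
          rw [Fin.sum_univ_eq_sum_range (fun i => i), Finset.sum_range_id_mul_two]
        have hs' : ((∑ i : Fin n, (i : ℕ) : ℕ) : ℝ) * 2 = n * (n - 1) := by
          rw [← Nat.cast_pred (by omega)]
          exact_mod_cast hs
        simp only [Fintype.card_sum, Fintype.card_sigma, Fintype.card_fin, Nat.cast_add]
        linarith)
    have hlt : ∀ i j : Fin n, j < i →
        ‖y i - y j‖ ≤ dimFactor (k + 1) n * |inner ℝ (y i - y j) w| := fun i j hij =>
      h (Sum.inl ⟨i, ⟨j, hij⟩⟩)
    refine ⟨w, hw, fun i j => ?_, fun j => h (Sum.inr j)⟩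
    rcases lt_trichotomy i j with hij | rfl | hij
    · have := hlt j i hij
      rwa [norm_sub_rev, ← neg_sub (y i), inner_neg_left, abs_neg] at this
    · simp
    · exact hlt i j hij

/-! ### Reduction of the general case to the line -/

theorem norm_lt_of_supNorm_lt {k : ℕ} {Ω σ : ℝ} {f : E k → ℂ}
    (h : supNorm Ω f < ENNReal.ofReal σ) {ω : E k} (hω : ‖ω‖ ≤ Ω) : ‖f ω‖ < σ := by
  have h1 : ‖f ω‖ₑ ≤ supNorm Ω f := le_iSup₂ (f := fun (ω : E k) (_ : ‖ω‖ ≤ Ω) => ‖f ω‖ₑ) ω hω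
  have h2 := h1.trans_lt h
  rw [← ofReal_norm] at h2
  exact ((ENNReal.ofReal_lt_ofReal_iff_of_nonneg (norm_nonneg _)).1 h2)

theorem norm_fourier_sub_fourier_le {k n : ℕ} {Ω σ : ℝ} {μ ν : DiscreteMeasure k n}
    {Y : E k → ℂ} (hY : IsMeasurement Ω σ μ Y) (hν : IsAdmissible Ω σ Y ν) {ω : E k}
    (hω : ‖ω‖ ≤ Ω) : ‖ν.fourier ω - μ.fourier ω‖ ≤ 2 * σ := by
  obtain ⟨W, hW, hWσ⟩ := hY
  have h1 := norm_lt_of_supNorm_lt hWσ hω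
  have h2 := norm_lt_of_supNorm_lt hν hω
  have e : ν.fourier ω - μ.fourier ω = (ν.fourier ω - Y ω) + W ω := by
    rw [hW ω hω]; ring
  rw [e]
  exact (norm_add_le _ _).trans (by linarith)

theorem DiscreteMeasure.fourier_smul {k n : ℕ} (μ : DiscreteMeasure k n) (w : E k) (t : ℝ) :
    μ.fourier (t • w) =
      ∑ j, μ.amp j * Complex.exp (Complex.I * ((inner ℝ (μ.loc j) w * t : ℝ) : ℂ)) := by
  simp only [DiscreteMeasure.fourier, inner_smul_right, mul_comm t]

theorem DiscreteMeasure.mMin_le {k n : ℕ} (μ : DiscreteMeasure k n) (j : Fin n) :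
    μ.mMin ≤ ‖μ.amp j‖ :=
  ciInf_le (Set.finite_range _).bddBelow j

theorem DiscreteMeasure.mMin_pos {k n : ℕ} (hn : 0 < n) (μ : DiscreteMeasure k n)
    (h : μ.IsSparse) : 0 < μ.mMin := by
  have : Nonempty (Fin n) := ⟨⟨0, hn⟩⟩
  obtain ⟨j, hj⟩ := exists_eq_ciInf_of_finite (f := fun j => ‖μ.amp j‖)
  rw [DiscreteMeasure.mMin, ← hj]
  exact norm_pos_iff.2 (h j)

theorem DiscreteMeasure.dMin_le {k n : ℕ} (μ : DiscreteMeasure k n) {p q : Fin n} (h : p ≠ q) :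
    μ.dMin ≤ ‖μ.loc p - μ.loc q‖ :=
  ciInf_le (f := fun q : {q : Fin n × Fin n // q.1 ≠ q.2} => ‖μ.loc q.1.1 - μ.loc q.1.2‖)
    (Set.finite_range _).bddBelow ⟨(p, q), h⟩

theorem dimFactor_pos (k n : ℕ) (hn : 2 ≤ n) : 0 < dimFactor k n := by
  have hn' : (2 : ℝ) ≤ n := by exact_mod_cast hn
  have : (0 : ℝ) < ((n : ℝ) + 2) * ((n : ℝ) - 1) / 2 := by
    have : (0 : ℝ) < (n : ℝ) - 1 := by linarith
    positivity
  unfold dimFactor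
  positivity

/-- Stability of the locations in `ℝᵏ`. -/
theorem exists_loc_near {k n : ℕ} (hk : 1 ≤ k) (hn : 2 ≤ n) {Ω σ : ℝ} (hΩ : 0 < Ω) (hσ : 0 < σ)
    {μ ν : DiscreteMeasure k n} {Y : E k → ℂ} (hsparse : μ.IsSparse)
    (hsupp : μ.SupportedInBall (((n : ℝ) - 1) * Real.pi / (2 * Ω)))
    (hY : IsMeasurement Ω σ μ Y) (hd : 0 < μ.dMin)
    (hsep : 5.88 * Real.pi * Real.exp 1 * dimFactor k n / Ω *
        (σ / μ.mMin) ^ (1 / (2 * (n : ℝ) - 1)) ≤ μ.dMin)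
    (hνsupp : ν.SupportedInBall (((n : ℝ) - 1) * Real.pi / (2 * Ω)))
    (hν : IsAdmissible Ω σ Y ν) (p : Fin n) :
    ∃ q, ν.loc q ∈ Metric.ball (μ.loc p) (μ.dMin / 2) ∧
      ‖ν.loc q - μ.loc p‖ ≤
        constC k n / Ω * srf Ω μ ^ (2 * n - 2) * (σ / μ.mMin) := by
  have hn' : (2 : ℝ) ≤ n := by exact_mod_cast hn
  have hpi := Real.pi_pos
  have hm := μ.mMin_pos (by omega) hsparse
  have hF := dimFactor_pos k n hn
  -- All `q` are included because the index of the near location is known only after projecting; the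
  -- direction may depend on `p`.
  obtain ⟨w, hw, h1, h2⟩ := exists_direction_dimFactor k n hk hn μ.loc
    (fun q => ν.loc q - μ.loc p)
  have hbound : ∀ v : E k, |inner ℝ v w| ≤ ‖v‖ := fun v => by
    simpa [hw] using abs_real_inner_le_norm v w
  obtain ⟨q, hq1, hq2⟩ := exists_location_near hn Ω σ μ.mMin (μ.dMin / dimFactor k n) hΩ hσ hm
    (by positivity) μ.amp ν.amp μ.mMin_le (fun j => inner ℝ (μ.loc j) w)
    (fun j => inner ℝ (ν.loc j) w) (fun j => (hbound _).trans (hsupp j))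
    (fun j => (hbound _).trans (hνsupp j))
    (fun t ht => by
      rw [← DiscreteMeasure.fourier_smul, ← DiscreteMeasure.fourier_smul]
      refine norm_fourier_sub_fourier_le hY hν ?_
      rwa [norm_smul, hw, mul_one])
    (fun i j hij => by
      rw [← inner_sub_left, div_le_iff₀ hF, mul_comm]
      exact (μ.dMin_le hij).trans (h1 i j))
    (by
      have hs : 0 < σ / μ.mMin := div_pos hσ hm
      have e : ((σ / μ.mMin) ^ (1 / (2 * (n : ℝ) - 1))) ^ (2 * n - 1) = σ / μ.mMin := by
        rw [← Real.rpow_natCast, ← Real.rpow_mul hs.le, Nat.cast_sub (by omega)]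
        push_cast
        rw [one_div_mul_cancel (by linarith), Real.rpow_one]
      calc _ = (5.88 * Real.pi * Real.exp 1 / Ω *
            (σ / μ.mMin) ^ (1 / (2 * (n : ℝ) - 1))) ^ (2 * n - 1) := by rw [mul_pow, e]
        _ ≤ _ := by
          gcongr
          rw [le_div_iff₀ hF]
          refine le_of_eq_of_le ?_ hsep
          ring) p
  rw [← inner_sub_left] at hq1 hq2
  have h3 := h2 q
  refine ⟨q, ?_, ?_⟩
  · rw [mem_ball_iff_norm]
    calc _ ≤ _ := h3
      _ < dimFactor k n * (μ.dMin / dimFactor k n / 2) := by gcongr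
      _ = μ.dMin / 2 := by field_simp
  · refine h3.trans ((mul_le_mul_of_nonneg_left hq2 hF.le).trans (le_of_eq ?_))
    -- One factor comes from lifting the error back to `ℝᵏ`, the other `2 * n - 2` from the reduced
    -- separation on the line.
    have e : dimFactor k n ^ (2 * n - 1) = dimFactor k n * dimFactor k n ^ (2 * n - 2) := by
      rw [← pow_succ']; congr 1; omega
    have e2 : Real.pi / (Ω * (μ.dMin / dimFactor k n)) = dimFactor k n * srf Ω μ := by
      rw [srf]; field_simp
    rw [constC, e, e2, mul_pow]
    ring

end PointSources

theorem theorem2p2 (k n : ℕ) (hk : 1 ≤ k) (hn : 2 ≤ n) (Ω σ : ℝ) (hΩ : 0 < Ω)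
    (μ : PointSources.DiscreteMeasure k n) (Y : PointSources.E k → ℂ)
    (hsparse : μ.IsSparse)
    (hsupp : μ.SupportedInBall (((n : ℝ) - 1) * Real.pi / (2 * Ω)))
    (hY : PointSources.IsMeasurement Ω σ μ Y)
    (hsep : 5.88 * Real.pi * Real.exp 1 * PointSources.dimFactor k n / Ω *
        (σ / μ.mMin) ^ (1 / (2 * (n : ℝ) - 1)) ≤ μ.dMin)
    (ν : PointSources.DiscreteMeasure k n)
    (hνsupp : ν.SupportedInBall (((n : ℝ) - 1) * Real.pi / (2 * Ω)))
    (hν : PointSources.IsAdmissible Ω σ Y ν) :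
    PointSources.WithinNeighborhood (μ.dMin / 2) ν μ ∧
      ∃ τ : Equiv.Perm (Fin n), ∀ j,
        ν.loc (τ j) ∈ Metric.ball (μ.loc j) (μ.dMin / 2) ∧
        ‖ν.loc (τ j) - μ.loc j‖ ≤
          PointSources.constC k n / Ω * PointSources.srf Ω μ ^ (2 * n - 2) * (σ / μ.mMin) := by
  -- A strict bound below `ENNReal.ofReal σ` already forces `σ` to be positive.
  have hσ : 0 < σ := ENNReal.ofReal_pos.1 (bot_le.trans_lt hν)
  have hm := μ.mMin_pos (by omega) hsparse
  have hF := PointSources.dimFactor_pos k n hn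
  have hd : 0 < μ.dMin := lt_of_lt_of_le (by positivity) hsep
  have hdisj : ∀ p q, p ≠ q →
      Disjoint (Metric.ball (μ.loc p) (μ.dMin / 2)) (Metric.ball (μ.loc q) (μ.dMin / 2)) :=
    fun p q hpq => Metric.ball_disjoint_ball (by
      rw [dist_eq_norm, add_halves]
      exact μ.dMin_le hpq)
  choose τ hτ using
    PointSources.exists_loc_near hk hn hΩ hσ hsparse hsupp hY hd hsep hνsupp hν
  have hunique : ∀ x p q, x ∈ Metric.ball (μ.loc p) (μ.dMin / 2) →
      x ∈ Metric.ball (μ.loc q) (μ.dMin / 2) → p = q := fun x p q hp hq => by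
    by_contra hne
    exact Set.disjoint_left.1 (hdisj p q hne) hp hq
  have hinj : Function.Injective τ := fun p q hpq =>
    hunique _ p q (hτ p).1 (hpq ▸ (hτ q).1)
  have hbij : Function.Bijective τ := Finite.injective_iff_bijective.1 hinj
  refine ⟨⟨by positivity, hdisj, fun j => ?_⟩, Equiv.ofBijective τ hbij, hτ⟩
  obtain ⟨p, rfl⟩ := hbij.2 j
  exact ⟨p, (hτ p).1, fun q hq => hunique _ q p hq (hτ p).1⟩
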